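/- Let $\Sigma$ be a finite alphabet with a reflexive and symmetric relation $\mathcal R$, and let $\mathcal M_\Sigma$ be the trace monoid generated by $\Sigma$ with the relations $ab=ba$ for all $(a,b)\notin\mathcal R$. For a trace $x$, let $|x|$ be its length, and let $\max(x)$ be the set of letters $a$ such that $x=y\cdot a$ for some trace $y$. Let $\mathscr L(a)=\{b\in\Sigma : (a,b)\in\mathcal R\}$. For $S\subseteq\Sigma$, let $\mathcal M_S$ be the submonoid generated by $S$, let $$\mu_S(X)=\sum_{U}(-1)^{|U|}X^{|U|},$$ where $U$ ranges over the subsets of $S$ whose distinct elements are pairwise unrelated by $\mathcal R$, and let $p_S$ be the smallest modulus of a complex root of $\mu_S$ (with $p_\emptyset=\infty$). For $p\in(0,p_S)$, let $B_{S,p}$ be the probability distribution on $\mathcal M_S$ defined by $B_{S,p}(x)=\mu_S(p)\,p^{|x|}$. Let $S$ and $T$ be subsets of $\Sigma$ and let $p\in(0,p_S)$ be a real number. Consider the following recursive random algorithm with input $(p,S,T)$. If $S\cap T=\emptyset$, return the empty trace. Otherwise choose $a\in S\cap T$, set $r=1-\mu_S(p)/\mu_{S\setminus\{a\}}(p)$,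 draw a random integer $K$ with $\mathbb P(K=k)=(1-r)r^k$ for all $k\geqslant 0$, and let $\xi$ be the empty trace; then, $K$ times in a row, let $v$ be the output of a new recursive call on input $(p,S\setminus\{a\},\mathscr L(a))$ and replace $\xi$ by $\xi\cdot v\cdot a$; finally let $v$ be the output of a recursive call on input $(p,S\setminus\{a\},T)$ and return $\xi\cdot v$. Whatever the rule used for choosing $a\in S\cap T$, the algorithm is well defined (every parameter $r$ that is used lies in $[0,1)$), and its output $\xi\in\mathcal M_\Sigma$ is distributed according to the conditional law $B_{S,p}(\,\cdot\mid\max(\xi)\subseteq T)$. Furthermore, assume that $\Sigma\neq\emptyset$, that the numbers $\mu_X(p)$, $X\subseteq\Sigma$, have been precomputed, that each elementary operation (choosing an element in the intersection of two subsets of $\Sigma$, function call, variable assignment, multiplication in $\mathcal M_\Sigma$, and the like) takes a constant number of steps, and that drawing a random integer takes at most $X$ steps when the integer drawn is $X$. Then the algorithm outputs $\xi$ in $\mathcal O\bigl(|\Sigma|(|\xi|+1)\bigr)$ steps, for every possible execution; the implied constant depends only on the costs of the elementary operations. -/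

import Mathlib

open scoped ENNReal

/-! ### Trace monoids -/

section TraceMonoids

variable {A : Type*}

/-- The relations `a b = b a`, for all pairs of letters that are not related by `R`. -/
inductive TraceRel (R : A → A → Prop) : FreeMonoid A → FreeMonoid A → Prop
  | swap (a b : A) (h : ¬ R a b) :
      TraceRel R (FreeMonoid.of a * FreeMonoid.of b) (FreeMonoid.of b * FreeMonoid.of a)

/-- The trace monoid over the alphabet `A` with dependence relation `R`. -/
abbrev TraceMonoid (R : A → A → Prop) : Type _ := PresentedMonoid (TraceRel R)

/-- All sets of traces are measurable. -/
instance (R : A → A → Prop) : MeasurableSpace (TraceMonoid R) := ⊤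

namespace TraceMonoid

variable (R : A → A → Prop)

/-- A letter, seen as a trace. -/
def letter (a : A) : TraceMonoid R := PresentedMonoid.of (TraceRel R) a

/-- The length of a trace, as a monoid homomorphism to `(ℕ, +)`. -/
def lengthHom : TraceMonoid R →* Multiplicative ℕ :=
  PresentedMonoid.lift (fun _ => Multiplicative.ofAdd 1) (by
    rintro _ _ ⟨a, b, _⟩
    simp)

variable {R}

/-- The length of a trace: the common length of the words that represent it. -/
def length (x : TraceMonoid R) : ℕ := (lengthHom R x).toAdd

/-- `max x`: the set of the possible last letters of the words that represent `x`, i.e. the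
labels of the maximal pieces of the heap of `x`. -/
def maxLetters (x : TraceMonoid R) : Set A := {a | ∃ y : TraceMonoid R, x = y * letter R a}

variable (R)

/-- The submonoid generated by a set `S` of letters. -/
def sub (S : Finset A) : Submonoid (TraceMonoid R) := Submonoid.closure (letter R '' (S : Set A))

open Classical in
/-- The set of letters (including `a`) that depend on the letter `a`. -/
noncomputable def link [Fintype A] (a : A) : Finset A := {b | R a b}

open Classical in
/-- The Möbius polynomial of the submonoid generated by `S`. A clique is identified with the set
of its letters, which is a set of distinct and pairwise independent letters. -/
noncomputable def mobius (S : Finset A) : Polynomial ℤ :=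
  ∑ U ∈ S.powerset with (∀ a ∈ U, ∀ b ∈ U, a ≠ b → ¬ R a b),
    (-1 : Polynomial ℤ) ^ U.card * Polynomial.X ^ U.card

/-- The value at a real number `p` of the Möbius polynomial. -/
noncomputable def mobiusAt (S : Finset A) (p : ℝ) : ℝ := Polynomial.aeval p (mobius R S)

/-- The smallest modulus of a complex root of the Möbius polynomial; it is `∞` when there is
no root, i.e. when `S` is empty. -/
noncomputable def minRoot (S : Finset A) : ℝ≥0∞ :=
  ⨅ (z : ℂ) (_ : Polynomial.aeval z (mobius R S) = 0), ‖z‖ₑ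

/-- The distribution that gives weight `μ_S(p) * p ^ |x|` to every trace `x` over the letters
of `S`, seen as a measure on the set of all traces. -/
noncomputable def boltzmann (S : Finset A) (p : ℝ) : MeasureTheory.Measure (TraceMonoid R) :=
  MeasureTheory.Measure.sum fun x : sub R S =>
    ENNReal.ofReal (mobiusAt R S p * p ^ length (x : TraceMonoid R)) •
      MeasureTheory.Measure.dirac (x : TraceMonoid R)

/-- The conditional distribution of a trace `x` under `boltzmann R S p`, given that
`max x ⊆ T`. -/
noncomputable def condBoltzmann (S T : Finset A) (p : ℝ) :
    MeasureTheory.Measure (TraceMonoid R) :=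
  ProbabilityTheory.cond (boltzmann R S p) {x | maxLetters x ⊆ (T : Set A)}

end TraceMonoid

end TraceMonoids

/-! ### Random computations with a step count -/

/-- A random computation. An outcome is either `none` (the computation has failed, because a
routine was called with an illegal parameter) or a pair `(a, n)` of the value `a` that is output
and the number `n` of steps that were executed. -/
def RandComp (α : Type*) : Type _ := PMF (Option (α × ℕ))

namespace RandComp

variable {α β : Type*}

/-- Output the value `a`, at no cost. -/
noncomputable def ret (a : α) : RandComp α := PMF.pure (some (a, 0))

/-- The computation that has failed. -/
noncomputable def fail : RandComp α := PMF.pure (none : Option (α × ℕ))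

/-- Execute `n` steps, then `m`. -/
noncomputable def tick (n : ℕ) (m : RandComp α) : RandComp α :=
  PMF.map (Option.map fun x : α × ℕ => (x.1, n + x.2)) m

/-- Execute `m`, then `f` with fresh randomness on the output of `m`; the step counts add up. -/
noncomputable def bind (m : RandComp α) (f : α → RandComp β) : RandComp β :=
  PMF.bind m fun o => match o with
    | none => fail
    | some x => tick x.2 (f x.1)

/-- The loop that executes `body` exactly `K` times on a variable. -/
noncomputable def loop (body : α → RandComp α) : ℕ → α → RandComp α
  | 0, x => ret x
  | K + 1, x => (body x).bind (loop body K)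

/-- The distribution of the output, regardless of the number of steps. -/
noncomputable def outputLaw (m : RandComp α) : PMF (Option α) := PMF.map (Option.map Prod.fst) m

/-- The possible outcomes, i.e. those of positive probability. -/
def outcomes (m : RandComp α) : Set (Option (α × ℕ)) := PMF.support m

end RandComp

/-- The geometric law of parameter `r` on `ℕ`: the integer `k` has probability `(1 - r) * r ^ k`. -/
noncomputable def geometricLaw (r : ℝ) (h0 : 0 ≤ r) (h1 : r < 1) : PMF ℕ :=
  ⟨fun k => ENNReal.ofReal ((1 - r) * r ^ k), by
    have hne : (1 - r) ≠ 0 := by linarith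
    have hs : HasSum (fun k : ℕ => (1 - r) * r ^ k) 1 := by
      have h := (hasSum_geometric_of_lt_one h0 h1).mul_left (1 - r)
      rwa [mul_inv_cancel₀ hne] at h
    have hn : ∀ k : ℕ, 0 ≤ (1 - r) * r ^ k := fun k =>
      mul_nonneg (by linarith) (pow_nonneg h0 k)
    have h := ENNReal.ofReal_tsum_of_nonneg hn hs.summable
    rw [hs.tsum_eq, ENNReal.ofReal_one] at h
    rw [h]
    exact ENNReal.summable.hasSum⟩

/-- The numbers of steps taken by the elementary operations: arbitrary constants, except for the
routine that draws a random integer, which takes at most `X` steps when it outputs `X`. -/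
structure StepCosts where
  /-- Test whether two sets of letters have an empty intersection. -/
  test : ℕ
  /-- Choose a letter in the intersection of two sets of letters. -/
  choose : ℕ
  /-- Look up a precomputed value of a Möbius polynomial. -/
  lookup : ℕ
  /-- One operation on real numbers. -/
  arith : ℕ
  /-- Remove a letter from a set, or look up the link of a letter. -/
  setOp : ℕ
  /-- Assign a value to a variable. -/
  assign : ℕ
  /-- Multiply two traces. -/
  mul : ℕ
  /-- Call a function. -/
  call : ℕ
  /-- Return a value. -/
  return_ : ℕ
  /-- Control of a loop, once for each passage and once more for the exit. -/
  loopControl : ℕ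
  /-- Draw a random integer `X` of geometric law with parameter `r`. -/
  randInt : (r : ℝ) → (X : ℕ) → ℕ
  randInt_le : ∀ r X, randInt r X ≤ X

/-- The routine that draws a random integer of geometric law with parameter `r`. It fails unless
`0 ≤ r < 1`. -/
noncomputable def drawGeometric (c : StepCosts) (r : ℝ) : RandComp ℕ :=
  open Classical in
  if h : 0 ≤ r ∧ r < 1 then
    PMF.map (fun K => some (K, c.randInt r K)) (geometricLaw r h.1 h.2)
  else RandComp.fail

/-- A rule for choosing a letter in the intersection of two sets of letters. -/
def ChoiceRule (A : Type*) [DecidableEq A] : Type _ :=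
  ∀ S T : Finset A, (S ∩ T).Nonempty → {a : A // a ∈ S ∩ T}

open RandComp TraceMonoid in
/-- The recursive random algorithm, on input `(p, S, T)`:
```
if S ∩ T = ∅ then return the empty trace
else
  choose a ∈ S ∩ T
  r ← 1 - μ_S(p) / μ_{S \ {a}}(p)
  K ← random integer of geometric law with parameter r
  ξ ← the empty trace
  for i = 0 to K - 1
    v ← output of the algorithm on input (p, S \ {a}, link a)
    ξ ← ξ * v * a
  v ← output of the algorithm on input (p, S \ {a}, T)
  ξ ← ξ * v
  return ξ
```
-/
noncomputable def traceAlgorithm {A : Type*} [Fintype A] [DecidableEq A] (R : A → A → Prop)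
    (c : StepCosts) (choose : ChoiceRule A) (p : ℝ) (S T : Finset A) :
    RandComp (TraceMonoid R) :=
  tick c.test <|
  if h : (S ∩ T).Nonempty then
    let a : A := choose S T h
    let r : ℝ := 1 - mobiusAt R S p / mobiusAt R (S.erase a) p
    -- the choice of `a`
    tick (c.choose + c.assign) <|
    -- the computation of `r`
    tick (c.setOp + 2 * c.lookup + 2 * c.arith + c.assign) <|
    (drawGeometric c r).bind fun K =>
    -- the assignments of `K` and of the initial value of `ξ`
    tick (2 * c.assign) <|
    (loop (fun ξ : TraceMonoid R =>
        tick (c.loopControl + 2 * c.setOp + c.call) <|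
        (traceAlgorithm R c choose p (S.erase a) (link R a)).bind fun v =>
        tick (c.assign + 2 * c.mul + c.assign) <|
        ret (ξ * v * letter R a)) K 1).bind fun ξ =>
    tick (c.loopControl + c.setOp + c.call) <|
    (traceAlgorithm R c choose p (S.erase a) T).bind fun v =>
    tick (c.assign + c.mul + c.assign) <|
    tick c.return_ <|
    ret (ξ * v)
  else
    tick c.return_ <| ret 1
termination_by S.card
decreasing_by
  all_goals
    exact Finset.card_erase_lt_of_mem (Finset.mem_inter.1 (choose S T h).2).1

/-! The algorithm inverts a unique factorization of traces. Fix a letter `a`. Every trace `x` is, in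
exactly one way, a product `y * v` where `a` is the only possible last letter of `y` and `a` does not
occur in `v` (`exists_cut`, `cut_unique`). When `y` contains `a`, it is `y' * u * a`, where `y' * u` is
again such a product, and all the last letters of `u` depend on `a`
(`maxLetters_mul_letter_subset_iff`). So `x` determines all the random choices that produce it: `K` is
the number of occurrences of `a`, and the recursive calls must output the successive factors `u`, then
`v`. These facts follow from Levi's lemma for letters (`levi`), which is proved by making the trace
monoid act on pairs formed by a trace and its quotient, if any, by a given letter.

By induction on `S`, the probability of the output `x` is then a product, in which `p` has exponent
`|x|` and the constants combine by the recursion `μ_S = μ_{S \ {a}} - X * μ_{S \ link a}`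
(`mobiusAt_eq_sub`). The result is `p ^ |x| * μ_S(p) / μ_{S \ T}(p)` whenever `x ∈ sub R S` has all its
last letters in `T`, and `0` otherwise (`outputLaw_traceAlgorithm`). Since the algorithm never fails,
these numbers add up to `1`. This gives the normalizing constant of the conditional law without a
separate computation of the generating series of the trace monoid.

The only analytic input is that the numbers `μ_{S'}(p)`, `S' ⊆ S`, are positive, so that the parameters
of the geometric laws lie in `(0, 1)` (`mobiusAt_pos`). It follows from the same recursion, by looking
at a first zero. The number of steps is bounded by induction on `S` (`returns_traceAlgorithm`). -/

/-! ### Letters of traces and division on the right -/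

namespace TraceMonoid

variable {A : Type*} {R : A → A → Prop}

/-- Induction on a trace by multiplying on the right by a letter. -/
theorem induction_right {motive : TraceMonoid R → Prop} (one : motive 1)
    (mul_letter : ∀ x a, motive x → motive (x * letter R a)) (x : TraceMonoid R) : motive x := by
  have hx : x ∈ Submonoid.closure (Set.range (letter R)) := by
    have h := PresentedMonoid.closure_range_of (TraceRel R)
    exact h.symm ▸ Submonoid.mem_top x
  induction hx using Submonoid.closure_induction_right with
  | one => exact one
  | mul_right x _ y hy ih =>
    obtain ⟨a, rfl⟩ := hy
    exact mul_letter x a ih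

theorem letter_mul_letter_comm {a b : A} (h : ¬ R a b) :
    letter R a * letter R b = letter R b * letter R a :=
  PresentedMonoid.mk_eq_mk_of_rel (TraceRel.swap a b h)

theorem length_one : length (1 : TraceMonoid R) = 0 := by
  simp [length]

theorem length_mul (x y : TraceMonoid R) : length (x * y) = length x + length y := by
  simp [length]

theorem length_letter (a : A) : length (letter R a) = 1 := rfl

open Classical in
/-- The number of occurrences in a trace of letters that satisfy `P`, as a monoid homomorphism
to `(ℕ, +)`. -/
noncomputable def countHom (P : A → Prop) : TraceMonoid R →* Multiplicative ℕ :=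
  PresentedMonoid.lift (fun a => Multiplicative.ofAdd (if P a then 1 else 0)) (by
    rintro _ _ ⟨a, b, _⟩
    simp [mul_comm])

/-- The number of occurrences in a trace of letters that satisfy `P`. -/
noncomputable def count (P : A → Prop) (x : TraceMonoid R) : ℕ := (countHom P x).toAdd

theorem count_one (P : A → Prop) : count P (1 : TraceMonoid R) = 0 := by
  simp [count]

theorem count_mul (P : A → Prop) (x y : TraceMonoid R) :
    count P (x * y) = count P x + count P y := by
  simp [count]

open Classical in
theorem count_letter (P : A → Prop) (a : A) :
    count P (letter R a) = if P a then 1 else 0 := rfl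

theorem mem_sub_iff_count {S : Finset A} {x : TraceMonoid R} :
    x ∈ sub R S ↔ count (· ∉ S) x = 0 := by
  constructor
  · intro h
    induction h using Submonoid.closure_induction with
    | mem x hx =>
      obtain ⟨a, ha, rfl⟩ := hx
      simpa [count_letter] using ha
    | one => exact count_one _
    | mul x y _ _ hx hy => rw [count_mul, hx, hy]
  · induction x using induction_right with
    | one => exact fun _ => one_mem _
    | mul_letter x a ih =>
      intro h
      rw [count_mul, count_letter, Nat.add_eq_zero_iff] at h
      refine mul_mem (ih h.1) (Submonoid.subset_closure ⟨a, ?_, rfl⟩)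
      by_contra ha
      simp_all

theorem mul_mem_sub {S : Finset A} {x y : TraceMonoid R} :
    x * y ∈ sub R S ↔ x ∈ sub R S ∧ y ∈ sub R S := by
  simp [mem_sub_iff_count, count_mul]

theorem letter_mem_sub {S : Finset A} {a : A} : letter R a ∈ sub R S ↔ a ∈ S := by
  simp [mem_sub_iff_count, count_letter]

theorem mem_sub_erase [DecidableEq A] {S : Finset A} {a : A} {x : TraceMonoid R} :
    x ∈ sub R (S.erase a) ↔ x ∈ sub R S ∧ count (· = a) x = 0 := by
  induction x using induction_right with
  | one => simp [one_mem, count_one]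
  | mul_letter x b ih =>
    simp only [mul_mem_sub, ih, letter_mem_sub, Finset.mem_erase, count_mul, count_letter]
    by_cases h : b = a <;> simp [h]
    tauto

open Classical in
/-- One step of the division on the right by the letter `b`. The state `(x, o)` consists of a
trace `x` and of the quotient `o` of `x` by `b`, if it exists; multiplying `x` by the letter `c`
updates the state. -/
noncomputable def divStep (b c : A) :
    Function.End (TraceMonoid R × Option (TraceMonoid R)) := fun s =>
  (s.1 * letter R c,
    if c = b then some s.1 else if R b c then none else s.2.map (· * letter R c))

theorem divStep_comm (b : A) {c d : A} (h : ¬ R c d) (h' : ¬ R d c) (hb : ∀ a, R a a)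
    (s : TraceMonoid R × Option (TraceMonoid R)) :
    divStep b d (divStep b c s) = divStep b c (divStep b d s) := by
  obtain ⟨x, o⟩ := s
  have hcd : letter R c * letter R d = letter R d * letter R c := letter_mul_letter_comm h
  have hne : c ≠ d := fun e => h (e ▸ hb c)
  simp only [divStep, Prod.mk.injEq, mul_assoc, hcd, true_and]
  by_cases hc : c = b
  · subst hc
    simp [hne.symm, h]
  · by_cases hd : d = b
    · subst hd
      simp [hc, h']
    · by_cases h1 : R b c <;> by_cases h2 : R b d <;> simp [hc, hd, h1, h2]
      cases o with
      | none => rfl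
      | some z => simp [hcd]

/-- The right action of the trace monoid that computes the quotient of a trace by `b`. -/
noncomputable def divHom (hrefl : ∀ a, R a a) (hsymm : ∀ a b, R a b → R b a) (b : A) :
    TraceMonoid R →* (Function.End (TraceMonoid R × Option (TraceMonoid R)))ᵐᵒᵖ :=
  PresentedMonoid.lift (rels := TraceRel R) (fun c => MulOpposite.op (divStep b c)) (by
    rintro _ _ ⟨c, d, h⟩
    simp only [map_mul, FreeMonoid.lift_eval_of]
    refine MulOpposite.unop_injective (funext fun s => ?_)
    exact divStep_comm b h (fun h' => h (hsymm _ _ h')) hrefl s)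

/-- The quotient on the right of a trace by a letter, if it exists. -/
noncomputable def div (hrefl : ∀ a, R a a) (hsymm : ∀ a b, R a b → R b a) (b : A)
    (x : TraceMonoid R) : Option (TraceMonoid R) :=
  ((divHom hrefl hsymm b x).unop (1, none)).2

section Levi

variable (hrefl : ∀ a, R a a) (hsymm : ∀ a b, R a b → R b a)

theorem divHom_mul_letter (b c : A) (x : TraceMonoid R)
    (s : TraceMonoid R × Option (TraceMonoid R)) :
    (divHom hrefl hsymm b (x * letter R c)).unop s =
      divStep b c ((divHom hrefl hsymm b x).unop s) := by
  rw [map_mul, MulOpposite.unop_mul]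
  rfl

theorem divHom_fst (b : A) (x : TraceMonoid R) :
    ((divHom hrefl hsymm b x).unop (1, none)).1 = x := by
  induction x using induction_right with
  | one => rw [map_one]; rfl
  | mul_letter x c ih => rw [divHom_mul_letter, divStep, ih]

open Classical in
theorem div_mul_letter (b c : A) (x : TraceMonoid R) :
    div hrefl hsymm b (x * letter R c) =
      if c = b then some x else if R b c then none
        else (div hrefl hsymm b x).map (· * letter R c) := by
  rw [div, divHom_mul_letter, divStep, divHom_fst]
  rfl

theorem eq_mul_of_div_eq_some (b : A) (x : TraceMonoid R) :
    ∀ z, div hrefl hsymm b x = some z → x = z * letter R b := by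
  induction x using induction_right with
  | one =>
    intro z h
    rw [div, map_one] at h
    cases (show none = some z from h)
  | mul_letter x c ih =>
    intro z h
    rw [div_mul_letter] at h
    split_ifs at h with h1 h2
    · cases h
      rw [h1]
    · obtain ⟨w, hw, rfl⟩ := Option.map_eq_some_iff.1 h
      rw [ih w hw, mul_assoc, mul_assoc,
        letter_mul_letter_comm (fun h' => h2 h')]

include hrefl hsymm

theorem mul_letter_cancel {b : A} {x y : TraceMonoid R}
    (h : x * letter R b = y * letter R b) : x = y := by
  have h' := congrArg (div hrefl hsymm b) h
  simpa [div_mul_letter] using h'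

/-- Levi's lemma for letters: two distinct last letters of a trace commute, and can be removed
together. -/
theorem levi {a b : A} (hab : a ≠ b) {x y : TraceMonoid R}
    (h : x * letter R a = y * letter R b) :
    ¬ R b a ∧ ∃ z, x = z * letter R b ∧ y = z * letter R a := by
  have h' := congrArg (div hrefl hsymm b) h
  rw [div_mul_letter, div_mul_letter, if_neg hab, if_pos rfl] at h'
  split_ifs at h' with h2
  obtain ⟨z, hz, hy⟩ := Option.map_eq_some_iff.1 h'
  exact ⟨h2, z, eq_mul_of_div_eq_some hrefl hsymm b x z hz, hy.symm⟩

omit hrefl hsymm in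
theorem mem_maxLetters_mul_left {b : A} {v : TraceMonoid R} (y : TraceMonoid R)
    (h : b ∈ maxLetters v) : b ∈ maxLetters (y * v) := by
  obtain ⟨w, rfl⟩ := h
  exact ⟨y * w, (mul_assoc _ _ _).symm⟩

omit hrefl hsymm in
theorem mem_maxLetters_mul_letter {a b : A} {x : TraceMonoid R} (hab : ¬ R b a)
    (h : b ∈ maxLetters x) : b ∈ maxLetters (x * letter R a) := by
  obtain ⟨w, rfl⟩ := h
  exact ⟨w * letter R a, by rw [mul_assoc, mul_assoc, letter_mul_letter_comm hab]⟩

theorem maxLetters_mul_subset (y v : TraceMonoid R) :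
    maxLetters (y * v) ⊆ maxLetters y ∪ maxLetters v := by
  induction v using induction_right with
  | one => simp
  | mul_letter w a ih =>
    rintro b ⟨z, hz⟩
    rw [← mul_assoc] at hz
    by_cases hab : a = b
    · subst hab
      exact Or.inr ⟨w, rfl⟩
    · obtain ⟨hR, u, hu, -⟩ := levi hrefl hsymm hab hz
      exact (ih ⟨u, hu⟩).imp_right fun h => mem_maxLetters_mul_letter hR h

omit hrefl hsymm in
theorem maxLetters_subset_of_mem_sub {S : Finset A} {x : TraceMonoid R} (h : x ∈ sub R S) :
    maxLetters x ⊆ S := by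
  rintro a ⟨y, rfl⟩
  exact letter_mem_sub.1 (mul_mem_sub.1 h).2

omit hrefl hsymm in
theorem eq_one_of_maxLetters_eq_empty {x : TraceMonoid R} (h : maxLetters x = ∅) : x = 1 := by
  induction x using induction_right with
  | one => rfl
  | mul_letter x a _ =>
    exact absurd (show a ∈ maxLetters (x * letter R a) from ⟨x, rfl⟩) (h ▸ Set.notMem_empty a)

omit hrefl hsymm in
theorem maxLetters_one : maxLetters (1 : TraceMonoid R) = ∅ := by
  ext a
  simp only [Set.mem_empty_iff_false, iff_false]
  rintro ⟨y, hy⟩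
  have := congrArg length hy
  rw [length_one, length_mul, length_letter] at this
  omega

/-! ### Cutting a trace at the last occurrence of a letter -/

omit hrefl hsymm in
/-- Every trace is the product of a trace with no last letter but `a` and of a trace in which `a`
does not occur. -/
theorem exists_cut (a : A) (x : TraceMonoid R) :
    ∃ y v, x = y * v ∧ maxLetters y ⊆ {a} ∧ count (· = a) v = 0 := by
  induction hn : length x generalizing x with
  | zero =>
    refine ⟨x, 1, (mul_one x).symm, ?_, count_one _⟩
    rintro b ⟨z, rfl⟩
    rw [length_mul, length_letter] at hn
    omega
  | succ n ih =>
    by_cases h : maxLetters x ⊆ {a}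
    · exact ⟨x, 1, (mul_one x).symm, h, count_one _⟩
    · obtain ⟨b, ⟨z, rfl⟩, hb⟩ := Set.not_subset.1 h
      obtain ⟨y, v, rfl, hy, hv⟩ := ih z (by
        rw [length_mul, length_letter] at hn
        omega)
      refine ⟨y, v * letter R b, mul_assoc _ _ _, hy, ?_⟩
      have hb' : b ≠ a := hb
      rw [count_mul, hv, count_letter, if_neg hb']

/-- The factorization of `exists_cut` is unique: a last letter of `v` is not `a`, so that it is a
last letter of `v'`, and both can be cancelled. -/
theorem cut_unique {a : A} {y y' : TraceMonoid R} (v v' : TraceMonoid R)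
    (h : y * v = y' * v') (hy : maxLetters y ⊆ {a}) (hy' : maxLetters y' ⊆ {a})
    (hv : count (· = a) v = 0) (hv' : count (· = a) v' = 0) : y = y' ∧ v = v' := by
  induction v using induction_right generalizing v' with
  | one =>
    induction v' using induction_right with
    | one => exact ⟨by simpa using h, rfl⟩
    | mul_letter w b _ =>
      exfalso
      have hb : b ∈ maxLetters y := ⟨y' * w, by rw [mul_assoc, ← h, mul_one]⟩
      rw [count_mul, count_letter, if_pos (show b = a from hy hb)] at hv'
      omega
  | mul_letter w b ih =>
    have hba : b ≠ a := by
      rintro rfl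
      rw [count_mul, count_letter, if_pos rfl] at hv
      omega
    have hb : b ∈ maxLetters (y' * v') := ⟨y * w, by rw [mul_assoc, ← h]⟩
    obtain hb | ⟨w', rfl⟩ := maxLetters_mul_subset hrefl hsymm y' v' hb
    · exact absurd (hy' hb) hba
    · rw [count_mul, Nat.add_eq_zero_iff] at hv hv'
      rw [← mul_assoc, ← mul_assoc] at h
      obtain ⟨h1, h2⟩ := ih w' (mul_letter_cancel hrefl hsymm h) hv.1 hv'.1
      exact ⟨h1, by rw [h2]⟩

/-- A product `y * v` has no last letter outside of `T` when the same holds for `v`, if `a ∈ T` is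
the only possible last letter of `y`. -/
theorem maxLetters_mul_subset_iff {a : A} {T : Set A} (ha : a ∈ T) {y v : TraceMonoid R}
    (hy : maxLetters y ⊆ {a}) : maxLetters (y * v) ⊆ T ↔ maxLetters v ⊆ T := by
  constructor
  · exact fun h b hb => h (mem_maxLetters_mul_left y hb)
  · intro h b hb
    obtain hb | hb := maxLetters_mul_subset hrefl hsymm y v hb
    · rwa [Set.mem_singleton_iff.1 (hy hb)]
    · exact h hb

omit hrefl hsymm in
theorem mem_link [Fintype A] {a b : A} : b ∈ link R a ↔ R a b := by
  simp [link]

/-- A trace `y * v * a`, where `y` has no last letter but `a`, has no last letter but `a` exactly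
when all the last letters of `v` depend on `a`. -/
theorem maxLetters_mul_letter_subset_iff [Fintype A] {a : A} {y v : TraceMonoid R}
    (hy : maxLetters y ⊆ {a}) :
    maxLetters (y * v * letter R a) ⊆ {a} ↔ maxLetters v ⊆ link R a := by
  constructor
  · intro h b hb
    by_contra hR
    rw [Finset.mem_coe, mem_link] at hR
    have hba : b = a :=
      h (mem_maxLetters_mul_letter (fun h' => hR (hsymm _ _ h')) (mem_maxLetters_mul_left y hb))
    exact hR (hba ▸ hrefl _)
  · rintro h b ⟨z, hz⟩
    by_contra hba
    obtain ⟨hR, u, hu, -⟩ := levi hrefl hsymm (Ne.symm hba) hz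
    obtain hb | hb := maxLetters_mul_subset hrefl hsymm y v ⟨u, hu⟩
    · exact hba (hy hb)
    · exact hR (hsymm _ _ ((mem_link).1 (h hb)))

end Levi

/-! ### Möbius polynomials -/

variable (R) in
/-- The distinct elements of `U` are pairwise unrelated by `R`. -/
def Independent (U : Finset A) : Prop := ∀ a ∈ U, ∀ b ∈ U, a ≠ b → ¬ R a b

open Classical in
theorem mobiusAt_eq_sum (S : Finset A) (p : ℝ) :
    mobiusAt R S p = ∑ U ∈ S.powerset, if Independent R U then (-p) ^ U.card else 0 := by
  simp only [mobiusAt, mobius, Finset.sum_filter, map_sum, ← neg_pow]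
  refine Finset.sum_congr rfl fun U _ => ?_
  by_cases h : Independent R U
  · rw [if_pos h, if_pos (by exact h)]
    simp
  · rw [if_neg h, if_neg (by exact h), map_zero]

theorem mobiusAt_zero (S : Finset A) : mobiusAt R S 0 = 1 := by
  classical
  rw [mobiusAt_eq_sum, Finset.sum_eq_single ∅] <;> simp +contextual [Independent]

theorem continuous_mobiusAt (S : Finset A) : Continuous (mobiusAt R S) := by
  unfold mobiusAt
  fun_prop

/-- Splitting the sum over the independent sets `U` according to whether `a ∈ U`. -/
theorem mobiusAt_eq_sub [Fintype A] [DecidableEq A] (hrefl : ∀ a, R a a)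
    (hsymm : ∀ a b, R a b → R b a) {S : Finset A} {a : A} (ha : a ∈ S) (p : ℝ) :
    mobiusAt R S p = mobiusAt R (S.erase a) p - p * mobiusAt R (S \ link R a) p := by
  classical
  have key : ∀ U ∈ (S.erase a).powerset,
      (if Independent R (insert a U)
        then (-p) ^ (insert a U).card else 0) =
      -p * (if U ∈ (S \ link R a).powerset ∧ Independent R U
        then (-p) ^ U.card else 0) := by
    intro U hU
    rw [Finset.mem_powerset] at hU
    have haU : a ∉ U := fun h => Finset.notMem_erase a S (hU h)
    have hiff : (Independent R (insert a U)) ↔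
        U ∈ (S \ link R a).powerset ∧ Independent R U := by
      rw [Finset.mem_powerset]
      constructor
      · refine fun h => ⟨fun x hx => ?_, fun x hx y hy => h x (by simp [hx]) y (by simp [hy])⟩
        rw [Finset.mem_sdiff, mem_link]
        exact ⟨Finset.mem_of_mem_erase (hU hx),
          h a (by simp) x (by simp [hx]) (fun e => haU (e ▸ hx))⟩
      · rintro ⟨h1, h2⟩ x hx y hy hxy
        have h3 : ∀ z ∈ U, ¬ R a z := fun z hz =>
          fun h => (Finset.mem_sdiff.1 (h1 hz)).2 ((mem_link).2 h)
        obtain hx | hx := Finset.mem_insert.1 hx <;> obtain hy | hy := Finset.mem_insert.1 hy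
        · exact absurd (hx.trans hy.symm) hxy
        · exact hx ▸ h3 y hy
        · exact hy ▸ fun h => h3 x hx (hsymm _ _ h)
        · exact h2 x hx y hy hxy
    rw [if_congr hiff rfl rfl, mul_ite, mul_zero, Finset.card_insert_of_notMem haU, pow_succ,
      mul_comm (-p)]
  have hsub : (S \ link R a).powerset ⊆ (S.erase a).powerset := by
    refine Finset.powerset_mono.2 fun x hx => ?_
    rw [Finset.mem_sdiff, mem_link] at hx
    exact Finset.mem_erase.2 ⟨fun e => hx.2 (e ▸ hrefl _), hx.1⟩
  have hlink : mobiusAt R (S \ link R a) p = ∑ U ∈ (S.erase a).powerset,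
      if U ∈ (S \ link R a).powerset ∧ Independent R U
        then (-p) ^ U.card else 0 := by
    rw [mobiusAt_eq_sum, ← Finset.sum_subset hsub]
    · exact Finset.sum_congr rfl fun U hU => by simp only [hU, true_and]
    · intro U _ hU
      simp only [hU, false_and, if_false]
  have hins := Finset.sum_powerset_insert (Finset.notMem_erase a S)
    fun U => if Independent R U then (-p) ^ U.card else 0
  rw [Finset.insert_erase ha, Finset.sum_congr rfl key, ← Finset.mul_sum, ← hlink,
    ← mobiusAt_eq_sum, ← mobiusAt_eq_sum] at hins
  rw [hins]
  ring

/-- If `μ_S` is positive on `[0, p]`, so is `μ_{S'}` for all subsets `S'` of `S`. By the recursion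
`μ_S = μ_{S \ {a}} - X * μ_{S \ link a}`, a first zero of `μ_{S \ {a}}` in `[0, p]` would be a point
where `μ_S ≤ 0`, as `μ_{S \ link a}` is, by induction, positive before it. -/
theorem mobiusAt_pos_of_subset [Fintype A] [DecidableEq A] (hrefl : ∀ a, R a a)
    (hsymm : ∀ a b, R a b → R b a) (S : Finset A) :
    ∀ p : ℝ, 0 ≤ p → (∀ x ∈ Set.Icc 0 p, 0 < mobiusAt R S x) →
      ∀ S' ⊆ S, 0 < mobiusAt R S' p := by
  induction S using Finset.strongInduction with
  | H S ih =>
    intro p hp hS S' hS'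
    obtain rfl | hss := hS'.eq_or_ssubset
    · exact hS p ⟨hp, le_rfl⟩
    obtain ⟨a, ha, haS'⟩ := Finset.exists_of_ssubset hss
    refine ih _ (Finset.erase_ssubset ha) p hp ?_ S' (Finset.subset_erase.2 ⟨hS', haS'⟩)
    by_contra! hneg
    let Z : Set ℝ := Set.Icc 0 p ∩ {x | mobiusAt R (S.erase a) x ≤ 0}
    have hZc : IsCompact Z := isCompact_Icc.inter_right
      (isClosed_le (continuous_mobiusAt _) continuous_const)
    obtain ⟨x₀, ⟨⟨hx0, hxp⟩, hx₀⟩, hmin⟩ := hZc.exists_isLeast hneg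
    have hpos : ∀ x ∈ Set.Ico 0 x₀, 0 < mobiusAt R (S \ link R a) x := by
      rintro x ⟨hx, hxx⟩
      refine ih _ (Finset.erase_ssubset ha) x hx (fun y hy => ?_) _ ?_
      · by_contra! hy'
        exact absurd (hmin ⟨⟨hy.1, by linarith [hy.2]⟩, hy'⟩) (by linarith [hy.2])
      · intro z hz
        rw [Finset.mem_sdiff, mem_link] at hz
        exact Finset.mem_erase.2 ⟨fun e => hz.2 (e ▸ hrefl _), hz.1⟩
    have hx0' : 0 < x₀ := by
      refine lt_of_le_of_ne hx0 fun e => ?_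
      have : mobiusAt R (S.erase a) x₀ ≤ 0 := hx₀
      rw [← e, mobiusAt_zero] at this
      linarith
    have hnonneg : 0 ≤ mobiusAt R (S \ link R a) x₀ := by
      have hcl : x₀ ∈ closure (Set.Ico 0 x₀) := by
        rw [closure_Ico hx0'.ne]
        exact ⟨hx0, le_rfl⟩
      exact closure_minimal (fun x hx => (hpos x hx).le)
        (isClosed_le continuous_const (continuous_mobiusAt _)) hcl
    have h1 := mobiusAt_eq_sub hrefl hsymm ha x₀
    have h2 := hS x₀ ⟨hx0, hxp⟩
    have h3 : mobiusAt R (S.erase a) x₀ ≤ 0 := hx₀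
    have h4 := mul_nonneg hx0 hnonneg
    linarith

/-- Below the smallest modulus of a root, the Möbius polynomials of all subsets are positive. -/
theorem mobiusAt_pos [Fintype A] [DecidableEq A] (hrefl : ∀ a, R a a)
    (hsymm : ∀ a b, R a b → R b a) {S : Finset A} {p : ℝ} (hp0 : 0 < p)
    (hp : ENNReal.ofReal p < minRoot R S) : ∀ S' ⊆ S, 0 < mobiusAt R S' p := by
  have hne : ∀ x ∈ Set.Icc 0 p, mobiusAt R S x ≠ 0 := by
    rintro x ⟨hx0, hxp⟩ hx
    have hroot : Polynomial.aeval (x : ℂ) (mobius R S) = 0 := by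
      have h := Polynomial.aeval_algebraMap_apply ℂ x (mobius R S)
      rw [show Polynomial.aeval x (mobius R S) = 0 from hx, map_zero] at h
      exact h
    have h1 : minRoot R S ≤ ‖(x : ℂ)‖ₑ := iInf₂_le (x : ℂ) hroot
    have h2 : ‖(x : ℂ)‖ₑ = ENNReal.ofReal x := by
      rw [← ofReal_norm, Complex.norm_real, Real.norm_of_nonneg hx0]
    exact absurd hp (not_lt.2 (h1.trans (h2.trans_le (ENNReal.ofReal_le_ofReal hxp))))
  refine mobiusAt_pos_of_subset hrefl hsymm S p hp0.le fun x hx => ?_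
  by_contra! hneg
  obtain ⟨y, hy, hy0⟩ := intermediate_value_Icc' hx.1 (continuous_mobiusAt (R := R) S).continuousOn
    ⟨hneg, by rw [mobiusAt_zero]; exact zero_le_one⟩
  exact hne y ⟨hy.1, hy.2.trans hx.2⟩ hy0

end TraceMonoid

/-! ### Output laws and outcomes of random computations -/

namespace RandComp

variable {α β : Type*}

theorem outputLaw_tick (n : ℕ) (m : RandComp α) : (tick n m).outputLaw = m.outputLaw := by
  refine (PMF.map_comp _ _ _).trans (congrArg (fun f => PMF.map f _) ?_)
  funext o
  cases o <;> rfl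

theorem outputLaw_ret_some [DecidableEq α] (a b : α) :
    (ret a).outputLaw (some b) = if b = a then 1 else 0 := by
  unfold outputLaw ret
  rw [PMF.pure_map, PMF.pure_apply]
  simp

theorem outputLaw_bind_some (m : RandComp α) (f : α → RandComp β) (b : β) :
    (m.bind f).outputLaw (some b) =
      ∑' a, m.outputLaw (some a) * (f a).outputLaw (some b) := by
  have h : (m.bind f).outputLaw = m.outputLaw.bind fun o => match o with
      | none => PMF.pure none
      | some a => (f a).outputLaw := by
    refine (PMF.map_bind _ _ _).trans (Eq.trans ?_ (PMF.bind_map _ _ _).symm)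
    refine congrArg (PMF.bind m) ?_
    funext o
    cases o with
    | none => exact PMF.pure_map _ _
    | some x => exact outputLaw_tick x.2 (f x.1)
  rw [h, PMF.bind_apply, ← (Option.some_injective α).tsum_eq]
  intro o ho
  cases o with
  | none => exact absurd (by simp) ho
  | some a => exact ⟨a, rfl⟩

theorem outputLaw_loop_succ_some (body : α → RandComp α) (K : ℕ) (x y : α) :
    (loop body (K + 1) x).outputLaw (some y) =
      ∑' z, (loop body K x).outputLaw (some z) * (body z).outputLaw (some y) := by
  classical
  induction K generalizing x with
  | zero =>
    simp only [loop, outputLaw_bind_some, outputLaw_ret_some]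
    rw [tsum_eq_single y (by simp +contextual [eq_comm]), tsum_eq_single x (by simp +contextual)]
    simp
  | succ K ih =>
    rw [loop, outputLaw_bind_some]
    simp only [ih, ← ENNReal.tsum_mul_left]
    rw [ENNReal.tsum_comm]
    refine tsum_congr fun z => ?_
    rw [loop, outputLaw_bind_some, ← ENNReal.tsum_mul_right]
    exact tsum_congr fun w => (mul_assoc _ _ _).symm

/-- The computation never fails, and all its outcomes `(a, n)` satisfy `Q`. -/
def Returns (m : RandComp α) (Q : α → ℕ → Prop) : Prop :=
  ∀ o ∈ m.outcomes, ∃ a n, o = some (a, n) ∧ Q a n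

theorem Returns.mono {m : RandComp α} {Q Q' : α → ℕ → Prop} (h : Returns m Q)
    (hQ : ∀ a n, Q a n → Q' a n) : Returns m Q' := fun o ho =>
  let ⟨a, n, ho', h'⟩ := h o ho
  ⟨a, n, ho', hQ a n h'⟩

theorem returns_ret {a : α} {Q : α → ℕ → Prop} (h : Q a 0) : Returns (ret a) Q := by
  intro o ho
  exact ⟨a, 0, (PMF.mem_support_pure_iff _ _).1 ho, h⟩

theorem Returns.tick {m : RandComp α} {k : ℕ} {Q : α → ℕ → Prop}
    (h : Returns m fun a n => Q a (k + n)) : Returns (RandComp.tick k m) Q := by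
  intro o ho
  obtain ⟨o', ho', rfl⟩ := (PMF.mem_support_map_iff _ _ _).1 ho
  obtain ⟨a, n, rfl, hQ⟩ := h o' ho'
  exact ⟨a, k + n, rfl, hQ⟩

theorem Returns.bind {m : RandComp α} {f : α → RandComp β} {P : α → ℕ → Prop}
    {Q : β → ℕ → Prop} (hm : Returns m P)
    (hf : ∀ a n, P a n → Returns (f a) fun b k => Q b (n + k)) : Returns (m.bind f) Q := by
  intro o ho
  obtain ⟨o', ho', h⟩ := (PMF.mem_support_bind_iff _ _ _).1 ho
  obtain ⟨a, n, rfl, hP⟩ := hm o' ho'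
  exact (hf a n hP).tick o h

theorem returns_loop {body : α → RandComp α} {P : α → α → ℕ → Prop}
    {Q : ℕ → α → α → ℕ → Prop} (hbody : ∀ x, Returns (body x) (P x)) (h0 : ∀ x, Q 0 x x 0)
    (hsucc : ∀ K x y z n k, P x y n → Q K y z k → Q (K + 1) x z (n + k)) (K : ℕ) (x : α) :
    Returns (loop body K x) (Q K x) := by
  induction K generalizing x with
  | zero => exact returns_ret (h0 x)
  | succ K ih =>
    exact (hbody x).bind fun y n hP => (ih y).mono fun z k hQ => hsucc K x y z n k hP hQ

theorem Returns.outputLaw_none {m : RandComp α} {Q : α → ℕ → Prop} (h : Returns m Q) :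
    m.outputLaw none = 0 := by
  by_contra hne
  obtain ⟨o, ho, hno⟩ := (PMF.mem_support_map_iff _ _ _).1 ((PMF.mem_support_iff _ _).2 hne)
  obtain ⟨a, n, rfl, -⟩ := h o ho
  simp at hno

end RandComp

open RandComp

theorem outputLaw_drawGeometric_some (c : StepCosts) {r : ℝ} (h0 : 0 ≤ r) (h1 : r < 1) (K : ℕ) :
    (drawGeometric c r).outputLaw (some K) = ENNReal.ofReal ((1 - r) * r ^ K) := by
  have h : (drawGeometric c r).outputLaw = PMF.map some (geometricLaw r h0 h1) :=
    (congrArg outputLaw (dif_pos ⟨h0, h1⟩)).trans (PMF.map_comp _ _ _)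
  rw [h, PMF.map_apply, tsum_eq_single K]
  · exact if_pos rfl
  · intro k hk
    simp [hk.symm]

theorem returns_drawGeometric (c : StepCosts) {r : ℝ} (h0 : 0 ≤ r) (h1 : r < 1) :
    Returns (drawGeometric c r) fun K n => n ≤ K := by
  intro o ho
  have h : drawGeometric c r = PMF.map (fun K => some (K, c.randInt r K)) (geometricLaw r h0 h1) :=
    dif_pos ⟨h0, h1⟩
  rw [h] at ho
  obtain ⟨K, -, rfl⟩ := (PMF.mem_support_map_iff _ _ _).1 ho
  exact ⟨K, _, rfl, c.randInt_le r K⟩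

namespace TraceMonoid

variable {A : Type*} {R : A → A → Prop}

/-! ### The law of the output -/

open Classical in
/-- The conditional probability of the trace `x`, in closed form: when a trace `y` has weight
`p ^ |y|`, the traces of `sub R S` with all their last letters in `T` have total weight
`μ_{S \ T}(p) / μ_S(p)`. -/
noncomputable def condWeight [DecidableEq A] (R : A → A → Prop) (S T : Finset A) (p : ℝ)
    (x : TraceMonoid R) : ℝ≥0∞ :=
  if x ∈ sub R S ∧ maxLetters x ⊆ T then
    ENNReal.ofReal (p ^ length x * (mobiusAt R S p / mobiusAt R (S \ T) p)) else 0

open Classical in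
/-- The probability that the loop of the algorithm, started at `1`, has value `x` after `K`
passages, where `q * p` is the normalizing constant `μ_{S \ {a}}(p) / μ_{(S \ {a}) \ link a}(p)` of the
law of the traces drawn in the loop. -/
noncomputable def loopWeight (S : Finset A) (a : A) (p q : ℝ) (K : ℕ) (x : TraceMonoid R) :
    ℝ≥0∞ :=
  if (x ∈ sub R S ∧ count (· = a) x = K) ∧ maxLetters x ⊆ {a} then
    ENNReal.ofReal (p ^ length x * q ^ K) else 0

section

variable (hrefl : ∀ a, R a a) (hsymm : ∀ a b, R a b → R b a)

include hrefl hsymm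

open Classical in
/-- A convolution of a weight on the traces with no last letter but `a` and of a weight on the
traces without `a` has a single non-zero term, by uniqueness of the cut. -/
theorem tsum_cut {a : A} {f g : TraceMonoid R → ℝ≥0∞}
    (hf : ∀ y, ¬ maxLetters y ⊆ {a} → f y = 0) (hg : ∀ v, count (· = a) v ≠ 0 → g v = 0)
    {y v : TraceMonoid R} (hy : maxLetters y ⊆ {a}) (hv : count (· = a) v = 0) :
    ∑' z, f z * ∑' w, g w * (if y * v = z * w then 1 else 0) = f y * g v := by
  have key : ∀ z w, f z * (g w * (if y * v = z * w then 1 else 0)) ≠ 0 → z = y ∧ w = v := by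
    intro z w h
    by_cases hz : maxLetters z ⊆ {a}
    · by_cases hw : count (· = a) w = 0
      · split_ifs at h with he
        · obtain ⟨h1, h2⟩ := cut_unique hrefl hsymm v w he hy hz hv hw
          exact ⟨h1.symm, h2.symm⟩
        · simp at h
      · simp [hg w hw] at h
    · simp [hf z hz] at h
  simp only [← ENNReal.tsum_mul_left]
  rw [tsum_eq_single y, tsum_eq_single v]
  · simp
  · exact fun w hw => by_contra fun h => hw (key y w h).2
  · exact fun z hz => ENNReal.tsum_eq_zero.2 fun w => by_contra fun h => hz (key z w h).1

open Classical in
theorem tsum_cut_mul_letter {a : A} {f g : TraceMonoid R → ℝ≥0∞}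
    (hf : ∀ y, ¬ maxLetters y ⊆ {a} → f y = 0) (hg : ∀ v, count (· = a) v ≠ 0 → g v = 0)
    {y v : TraceMonoid R} (hy : maxLetters y ⊆ {a}) (hv : count (· = a) v = 0) :
    ∑' z, f z * ∑' w, g w * (if y * v * letter R a = z * w * letter R a then 1 else 0) =
      f y * g v := by
  rw [← tsum_cut hrefl hsymm hf hg hy hv]
  have h : ∀ z w : TraceMonoid R,
      y * v * letter R a = z * w * letter R a ↔ y * v = z * w := fun z w =>
    ⟨mul_letter_cancel hrefl hsymm, fun e => by rw [e]⟩
  simp only [h]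

omit hrefl hsymm in
theorem condWeight_erase_eq_zero [DecidableEq A] {S T : Finset A} {p : ℝ} {a : A}
    {v : TraceMonoid R} (hv : count (· = a) v ≠ 0) : condWeight R (S.erase a) T p v = 0 :=
  if_neg fun h => hv (mem_sub_erase.1 h.1).2

/-- One passage of the loop multiplies `y` by `v * a`, where `v` has weight `p ^ |v| * (q * p)`. -/
theorem loopWeight_mul [Fintype A] [DecidableEq A] {S : Finset A} {a : A} (ha : a ∈ S) {p q : ℝ}
    (hp : 0 ≤ p) (hq : 0 ≤ q)
    (hqp : mobiusAt R (S.erase a) p / mobiusAt R (S.erase a \ link R a) p = q * p) {K : ℕ}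
    {y v : TraceMonoid R} (hy : maxLetters y ⊆ {a}) (hv : count (· = a) v = 0) :
    loopWeight S a p q (K + 1) (y * v * letter R a) =
      loopWeight S a p q K y * condWeight R (S.erase a) (link R a) p v := by
  have hiff : ((y * v * letter R a ∈ sub R S ∧ count (· = a) (y * v * letter R a) = K + 1) ∧
      maxLetters (y * v * letter R a) ⊆ {a}) ↔
      ((y ∈ sub R S ∧ count (· = a) y = K) ∧ maxLetters y ⊆ {a}) ∧
        (v ∈ sub R (S.erase a) ∧ maxLetters v ⊆ link R a) := by
    rw [maxLetters_mul_letter_subset_iff hrefl hsymm hy, mul_mem_sub, mul_mem_sub, letter_mem_sub,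
      mem_sub_erase, count_mul, count_mul, count_letter, if_pos rfl, hv, add_zero,
      Nat.add_right_cancel_iff]
    tauto
  unfold loopWeight condWeight
  rw [hqp]
  by_cases h : ((y ∈ sub R S ∧ count (· = a) y = K) ∧ maxLetters y ⊆ {a}) ∧
      (v ∈ sub R (S.erase a) ∧ maxLetters v ⊆ link R a)
  · rw [if_pos (hiff.2 h), if_pos h.1, if_pos h.2, ← ENNReal.ofReal_mul (by positivity)]
    rw [length_mul, length_mul, length_letter]
    congr 1
    ring
  · rw [if_neg (mt hiff.1 h)]
    rw [not_and_or] at h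
    obtain h | h := h
    · rw [if_neg h, zero_mul]
    · rw [if_neg h, mul_zero]

/-- The law of the loop after `K` passages. -/
theorem outputLaw_loop [Fintype A] [DecidableEq A] {S : Finset A} {a : A} (ha : a ∈ S) {p q : ℝ}
    (hp : 0 ≤ p) (hq : 0 ≤ q)
    (hqp : mobiusAt R (S.erase a) p / mobiusAt R (S.erase a \ link R a) p = q * p)
    {body : TraceMonoid R → RandComp (TraceMonoid R)}
    (hbody : ∀ z y, open Classical in (body z).outputLaw (some y) =
      ∑' v, condWeight R (S.erase a) (link R a) p v * (if y = z * v * letter R a then 1 else 0))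
    (K : ℕ) (y : TraceMonoid R) :
    (loop body K 1).outputLaw (some y) = loopWeight S a p q K y := by
  classical
  induction K generalizing y with
  | zero =>
    rw [loop, outputLaw_ret_some, loopWeight]
    by_cases hy : y = 1
    · rw [if_pos hy, if_pos, hy, length_one]
      · simp
      · rw [hy, maxLetters_one, count_one]
        exact ⟨⟨one_mem _, rfl⟩, Set.empty_subset _⟩
    · rw [if_neg hy, if_neg]
      rintro ⟨⟨-, hcount⟩, hmax⟩
      refine hy (eq_one_of_maxLetters_eq_empty (Set.eq_empty_of_forall_notMem ?_))
      rintro b ⟨z, rfl⟩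
      rw [count_mul, count_letter, if_pos (show b = a from hmax ⟨z, rfl⟩)] at hcount
      omega
  | succ K ih =>
    rw [outputLaw_loop_succ_some]
    simp only [ih, hbody]
    by_cases hmax : a ∈ maxLetters y
    · obtain ⟨x, rfl⟩ := hmax
      obtain ⟨z, v, rfl, hz, hv⟩ := exists_cut a x
      rw [loopWeight_mul hrefl hsymm ha hp hq hqp hz hv]
      exact tsum_cut_mul_letter hrefl hsymm (fun y hy => if_neg fun h => hy h.2)
        (fun v => condWeight_erase_eq_zero) hz hv
    · have hne : ∀ z v, y ≠ z * v * letter R a := fun z v e => hmax ⟨z * v, e⟩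
      simp only [hne, if_false, mul_zero, tsum_zero]
      refine (if_neg ?_).symm
      rintro ⟨⟨-, hK⟩, hy⟩
      have h1 : y = 1 := eq_one_of_maxLetters_eq_empty <|
        Set.eq_empty_of_forall_notMem fun b hb => hmax (hy hb ▸ hb)
      rw [h1, count_one] at hK
      omega

omit hrefl hsymm in
/-- The law of the output of the algorithm when `S ∩ T = ∅`. -/
theorem condWeight_of_inter_eq_empty [DecidableEq A] {S T : Finset A} {p : ℝ}
    (hS : 0 < mobiusAt R S p) (h : S ∩ T = ∅) (x : TraceMonoid R) :
    open Classical in condWeight R S T p x = if x = 1 then 1 else 0 := by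
  have hST : S \ T = S :=
    Finset.sdiff_eq_self_iff_disjoint.2 (Finset.disjoint_iff_inter_eq_empty.2 h)
  rw [condWeight, hST, div_self hS.ne', mul_one]
  by_cases hx : x = 1
  · rw [if_pos hx, if_pos, hx, length_one]
    · simp
    · rw [hx, maxLetters_one]
      exact ⟨one_mem _, Set.empty_subset _⟩
  · rw [if_neg hx, if_neg]
    rintro ⟨hxS, hxT⟩
    refine hx (eq_one_of_maxLetters_eq_empty (Set.eq_empty_of_forall_notMem fun b hb => ?_))
    have hb' : b ∈ S ∩ T :=
      Finset.mem_inter.2 ⟨maxLetters_subset_of_mem_sub hxS hb, hxT hb⟩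
    rw [h] at hb'
    exact Finset.notMem_empty b hb'

/-- Averaging over the random number `K` of passages relates the conditional weights for `S` and
`S \ {a}`. Only the term where `K` is the number of occurrences of `a` in `y` contributes, and there
`q = r⁻¹` makes `r ^ K * q ^ K` equal to `1`. -/
theorem condWeight_mul [DecidableEq A] {S T : Finset A} {a : A}
    (haT : a ∈ T) {p q r : ℝ} (hp : 0 ≤ p) (hq : 0 ≤ q) (hr0 : 0 ≤ r) (hr1 : r < 1)
    (hrq : r * q = 1) (hr : 1 - r = mobiusAt R S p / mobiusAt R (S.erase a) p)
    (hS : 0 < mobiusAt R (S.erase a) p)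
    {y v : TraceMonoid R} (hy : maxLetters y ⊆ {a}) (hv : count (· = a) v = 0) :
    ∑' K, ENNReal.ofReal ((1 - r) * r ^ K) *
      (loopWeight S a p q K y * condWeight R (S.erase a) T p v) =
      condWeight R S T p (y * v) := by
  rw [tsum_eq_single (count (· = a) y)]
  swap
  · intro K hK
    rw [loopWeight, if_neg fun h => hK h.1.2.symm, zero_mul, mul_zero]
  have hsd : S.erase a \ T = S \ T := by
    ext b
    simp only [Finset.mem_sdiff, Finset.mem_erase]
    exact ⟨fun h => ⟨h.1.2, h.2⟩, fun h => ⟨⟨fun e => h.2 (e ▸ haT), h.1⟩, h.2⟩⟩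
  have hiff : (y * v ∈ sub R S ∧ maxLetters (y * v) ⊆ T) ↔
      ((y ∈ sub R S ∧ count (· = a) y = count (· = a) y) ∧ maxLetters y ⊆ {a}) ∧
        (v ∈ sub R (S.erase a) ∧ maxLetters v ⊆ T) := by
    rw [maxLetters_mul_subset_iff hrefl hsymm haT hy, mul_mem_sub, mem_sub_erase]
    tauto
  unfold loopWeight condWeight
  rw [hsd]
  by_cases h : ((y ∈ sub R S ∧ count (· = a) y = count (· = a) y) ∧ maxLetters y ⊆ {a}) ∧
        (v ∈ sub R (S.erase a) ∧ maxLetters v ⊆ T)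
  · have h1r : 0 ≤ 1 - r := by linarith
    rw [if_pos (hiff.2 h), if_pos h.1, if_pos h.2, ← ENNReal.ofReal_mul (by positivity),
      ← ENNReal.ofReal_mul (by positivity), length_mul]
    congr 1
    have hpow : r ^ count (· = a) y * q ^ count (· = a) y = 1 := by rw [← mul_pow, hrq, one_pow]
    have hmu : mobiusAt R S p = (1 - r) * mobiusAt R (S.erase a) p := by
      rw [hr, div_mul_cancel₀ _ hS.ne']
    rw [hmu, pow_add]
    linear_combination (1 - r) * p ^ length y * p ^ length v *
      (mobiusAt R (S.erase a) p / mobiusAt R (S \ T) p) * hpow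
  · rw [if_neg (mt hiff.1 h)]
    rw [not_and_or] at h
    obtain h | h := h
    · rw [if_neg h, zero_mul, mul_zero]
    · rw [if_neg h, mul_zero, mul_zero]

/-- The parameter of the geometric law lies in `(0, 1)`; it is the product of `p` and of
`μ_{(S \ {a}) \ link a}(p) / μ_{S \ {a}}(p)`, which is the total weight of the traces over `S \ {a}`
with all their last letters in `link a`. -/
theorem geometric_parameter [Fintype A] [DecidableEq A] {S : Finset A} {a : A}
    (ha : a ∈ S) {p : ℝ} (hp : 0 < p) (hpos : ∀ S' ⊆ S, 0 < mobiusAt R S' p) :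
    1 - mobiusAt R S p / mobiusAt R (S.erase a) p =
        p * (mobiusAt R (S.erase a \ link R a) p / mobiusAt R (S.erase a) p) ∧
      0 < 1 - mobiusAt R S p / mobiusAt R (S.erase a) p ∧
      1 - mobiusAt R S p / mobiusAt R (S.erase a) p < 1 := by
  have hsd : S.erase a \ link R a = S \ link R a := by
    ext b
    simp only [Finset.mem_sdiff, Finset.mem_erase, mem_link]
    exact ⟨fun h => ⟨h.1.2, h.2⟩, fun h => ⟨⟨fun e => h.2 (e ▸ hrefl _), h.1⟩, h.2⟩⟩
  have h1 : 0 < mobiusAt R (S.erase a) p := hpos _ (Finset.erase_subset _ _)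
  have h2 : 0 < mobiusAt R (S \ link R a) p := hpos _ Finset.sdiff_subset
  have h3 : 1 - mobiusAt R S p / mobiusAt R (S.erase a) p =
      p * (mobiusAt R (S.erase a \ link R a) p / mobiusAt R (S.erase a) p) := by
    rw [mobiusAt_eq_sub hrefl hsymm ha, hsd]
    field_simp
    ring
  refine ⟨h3, ?_, ?_⟩
  · rw [h3, hsd]
    positivity
  · have := div_pos (hpos S subset_rfl) h1
    linarith

/-- The output is `x` with probability `condWeight R S T p x`: all the executions that output `x`
go through the same cut of `x`. -/
theorem outputLaw_traceAlgorithm [Fintype A] [DecidableEq A] (c : StepCosts)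
    (choose : ChoiceRule A) {p : ℝ} (hp : 0 < p) (S : Finset A)
    (hpos : ∀ S' ⊆ S, 0 < mobiusAt R S' p) (T : Finset A) (x : TraceMonoid R) :
    (traceAlgorithm R c choose p S T).outputLaw (some x) = condWeight R S T p x := by
  classical
  induction S using Finset.strongInduction generalizing T x with
  | H S ih =>
    rw [traceAlgorithm, outputLaw_tick]
    by_cases h : (S ∩ T).Nonempty
    · rw [dif_pos h]
      obtain ⟨a, haST⟩ := choose S T h
      obtain ⟨ha, haT⟩ := Finset.mem_inter.1 haST
      obtain ⟨hr, hr0, hr1⟩ := geometric_parameter hrefl hsymm ha hp hpos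
      have ih' := ih _ (Finset.erase_ssubset ha)
        fun S' hS' => hpos S' (hS'.trans (Finset.erase_subset _ _))
      have h1 : 0 < mobiusAt R (S.erase a) p := hpos _ (Finset.erase_subset _ _)
      have h2 : 0 < mobiusAt R (S.erase a \ link R a) p :=
        hpos _ (Finset.sdiff_subset.trans (Finset.erase_subset _ _))
      dsimp only
      set r := 1 - mobiusAt R S p / mobiusAt R (S.erase a) p with hrdef
      have hq : 0 ≤ r⁻¹ := (inv_pos.2 hr0).le
      have hqp : mobiusAt R (S.erase a) p / mobiusAt R (S.erase a \ link R a) p = r⁻¹ * p := by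
        rw [hr]
        field_simp
      obtain ⟨y, v, rfl, hy, hv⟩ := exists_cut a x
      rw [outputLaw_tick, outputLaw_tick, outputLaw_bind_some,
        ← condWeight_mul hrefl hsymm haT hp.le hq hr0.le hr1 (mul_inv_cancel₀ hr0.ne')
          (by rw [hrdef]; ring) h1 hy hv]
      refine tsum_congr fun K => ?_
      rw [outputLaw_drawGeometric_some c hr0.le hr1, outputLaw_tick, outputLaw_bind_some,
        ← tsum_cut hrefl hsymm (f := loopWeight S a p r⁻¹ K) (g := condWeight R (S.erase a) T p)
          (fun y hy => if_neg fun h => hy h.2) (fun v => condWeight_erase_eq_zero) hy hv]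
      congr 1
      refine tsum_congr fun z => ?_
      rw [outputLaw_loop hrefl hsymm ha hp.le hq hqp]
      · simp only [outputLaw_tick, outputLaw_bind_some, outputLaw_ret_some, ih']
      · intro z y
        simp only [outputLaw_tick, outputLaw_bind_some, outputLaw_ret_some, ih']
    · rw [dif_neg h, outputLaw_tick, outputLaw_ret_some,
        condWeight_of_inter_eq_empty (hpos S subset_rfl)
          (Finset.not_nonempty_iff_eq_empty.1 h)]

/-! ### The number of steps -/

/-- The number of steps is at most `α + β * |S| * (|ξ| + 1)`, by induction on `|S|`. If the loop is
executed `K` times, the lengths of the outputs of the `K + 1` recursive calls add up to `|ξ| - K`, so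
that the bounds for these calls add up to `(K + 1) * α + β * (|S| - 1) * (|ξ| + 1)`. As `K ≤ |ξ|`, one
more term `β * (|ξ| + 1)` pays for `K * α`, for the random integer `K`, and for the other steps. -/
theorem returns_traceAlgorithm [Fintype A] [DecidableEq A] (c : StepCosts)
    (choose : ChoiceRule A) {p : ℝ} (hp : 0 < p) (α β : ℕ) (hα : c.test + c.return_ ≤ α)
    (hβ : α + (c.test + (c.choose + c.assign) +
        (c.setOp + 2 * c.lookup + 2 * c.arith + c.assign) + 2 * c.assign +
        (c.loopControl + c.setOp + c.call) + (c.assign + c.mul + c.assign) + c.return_) +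
      (c.loopControl + 2 * c.setOp + c.call) + (c.assign + 2 * c.mul + c.assign) + 1 ≤ β)
    (S : Finset A) (hpos : ∀ S' ⊆ S, 0 < mobiusAt R S' p) (T : Finset A) :
    Returns (traceAlgorithm R c choose p S T) fun ξ n =>
      n ≤ α + β * S.card * (length ξ + 1) := by
  induction S using Finset.strongInduction generalizing T with
  | H S ih =>
    rw [traceAlgorithm]
    refine Returns.tick ?_
    by_cases h : (S ∩ T).Nonempty
    · rw [dif_pos h]
      obtain ⟨a, haST⟩ := choose S T h
      obtain ⟨ha, -⟩ := Finset.mem_inter.1 haST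
      obtain ⟨-, hr0, hr1⟩ := geometric_parameter hrefl hsymm ha hp hpos
      have ih' := ih _ (Finset.erase_ssubset ha)
        fun S' hS' => hpos S' (hS'.trans (Finset.erase_subset _ _))
      dsimp only
      rw [← Finset.card_erase_add_one ha]
      generalize (S.erase a).card = s at ih' ⊢
      refine Returns.tick (Returns.tick ((returns_drawGeometric c hr0.le hr1).bind ?_))
      intro K nK hnK
      refine Returns.tick (Returns.bind (returns_loop
        (P := fun x y n => ∃ v : TraceMonoid R, y = x * v * letter R a ∧
          n ≤ (c.loopControl + 2 * c.setOp + c.call) + (c.assign + 2 * c.mul + c.assign) +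
            (α + β * s * (length v + 1)))
        (Q := fun K x y n => length x + K ≤ length y ∧ n + β * s * length x ≤
          K * ((c.loopControl + 2 * c.setOp + c.call) + (c.assign + 2 * c.mul + c.assign) + α) +
            β * s * length y) ?_ ?_ ?_ K 1) ?_)
      · intro x
        refine Returns.tick ((ih' _).bind fun v n hn => Returns.tick (returns_ret ⟨v, rfl, ?_⟩))
        omega
      · intro x
        simp
      · rintro K x _ z n k ⟨v, rfl, hn⟩ ⟨hlen, hk⟩
        rw [length_mul, length_mul, length_letter] at hlen hk
        refine ⟨by omega, ?_⟩
        rw [add_one_mul]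
        simp only [mul_add, mul_one] at hn hk ⊢
        omega
      · rintro y n ⟨hlen, hn⟩
        refine Returns.tick ((ih' _).bind fun v m hm =>
          Returns.tick (Returns.tick (returns_ret ?_)))
        rw [length_one, mul_zero] at hn
        rw [length_one] at hlen
        rw [length_mul]
        have hK : β * (K + 1) ≤ β * (length y + length v + 1) :=
          Nat.mul_le_mul_left _ (by omega)
        generalize hD₁ : (c.loopControl + 2 * c.setOp + c.call) +
          (c.assign + 2 * c.mul + c.assign) = D₁ at hn
        obtain ⟨D₀, hD₀⟩ : ∃ D₀, D₀ = c.test + (c.choose + c.assign) +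
          (c.setOp + 2 * c.lookup + 2 * c.arith + c.assign) + 2 * c.assign +
          (c.loopControl + c.setOp + c.call) + (c.assign + c.mul + c.assign) + c.return_ :=
          ⟨_, rfl⟩
        -- the steps of the call itself and of its loop are paid by the factor `K + 1`
        have hpay : D₀ + K * (D₁ + α) + K ≤ β * (K + 1) :=
          calc D₀ + K * (D₁ + α) + K ≤ D₀ + K * (D₁ + α) + K + (D₀ * K + α + D₁ + 1) :=
                Nat.le_add_right _ _
            _ = (α + D₀ + D₁ + 1) * (K + 1) := by ring
            _ ≤ β * (K + 1) := Nat.mul_le_mul_right _ (by omega)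
        have hsplit : α + β * (s + 1) * (length y + length v + 1) =
            α + β * (length y + length v + 1) + β * s * length y + β * s * (length v + 1) := by
          ring
        rw [hsplit]
        omega
    · rw [dif_neg h]
      refine Returns.tick (returns_ret ?_)
      rw [add_zero]
      exact hα.trans (Nat.le_add_right _ _)

end

/-! ### The conditional law -/

theorem measurableSet (s : Set (TraceMonoid R)) : MeasurableSet s := trivial

theorem boltzmann_inter [DecidableEq A] {S T : Finset A} {p : ℝ} (hp : 0 < p)
    (hS : 0 < mobiusAt R S p) (hST : 0 < mobiusAt R (S \ T) p) (F : Set (TraceMonoid R)) :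
    boltzmann R S p ({x | maxLetters x ⊆ (T : Set A)} ∩ F) =
      ENNReal.ofReal (mobiusAt R (S \ T) p) * ∑' x, F.indicator (condWeight R S T p) x := by
  classical
  rw [boltzmann, MeasureTheory.Measure.sum_apply _ (measurableSet _), ← ENNReal.tsum_mul_left]
  have hsub := tsum_subtype (sub R S : Set (TraceMonoid R)) fun x =>
    (ENNReal.ofReal (mobiusAt R S p * p ^ length x) • MeasureTheory.Measure.dirac x)
      ({x | maxLetters x ⊆ (T : Set A)} ∩ F)
  refine hsub.trans (tsum_congr fun x => ?_)
  rw [Set.indicator_apply, Set.indicator_apply, MeasureTheory.Measure.smul_apply,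
    MeasureTheory.Measure.dirac_apply' _ (measurableSet _), condWeight, Set.indicator_apply]
  by_cases h1 : x ∈ sub R S <;> by_cases h2 : maxLetters x ⊆ (T : Set A) <;>
    by_cases h3 : x ∈ F <;> simp [h1, h2, h3]
  rw [← ENNReal.ofReal_mul hST.le]
  congr 1
  field_simp

/-- The conditional law has the closed form `condWeight`, provided that the latter sums to `1`. -/
theorem condBoltzmann_singleton [DecidableEq A] {S T : Finset A} {p : ℝ} (hp : 0 < p)
    (hS : 0 < mobiusAt R S p) (hST : 0 < mobiusAt R (S \ T) p)
    (hsum : ∑' x, condWeight R S T p x = 1) (x : TraceMonoid R) :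
    condBoltzmann R S T p {x} = condWeight R S T p x := by
  classical
  have hE : boltzmann R S p {x | maxLetters x ⊆ (T : Set A)} =
      ENNReal.ofReal (mobiusAt R (S \ T) p) := by
    have h := boltzmann_inter hp hS hST Set.univ
    rwa [Set.inter_univ, Set.indicator_univ, hsum, mul_one] at h
  have hx : ∑' y, ({x} : Set (TraceMonoid R)).indicator (condWeight R S T p) y =
      condWeight R S T p x := by
    rw [tsum_eq_single x fun y hy => Set.indicator_of_notMem (by simpa using hy) _,
      Set.indicator_of_mem (Set.mem_singleton x)]
  rw [condBoltzmann, ProbabilityTheory.cond_apply (measurableSet _), hE, boltzmann_inter hp hS hST, hx,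
    ← mul_assoc,
    ENNReal.inv_mul_cancel (by simpa using hST) ENNReal.ofReal_ne_top, one_mul]

end TraceMonoid

theorem theorem2 (c : StepCosts) :
    ∃ C : ℕ, ∀ (A : Type*) [Fintype A] [DecidableEq A] (R : A → A → Prop)
      (_hrefl : ∀ a, R a a) (_hsymm : ∀ a b, R a b → R b a)
      (choose : ChoiceRule A) (S T : Finset A) (p : ℝ)
      (_hp0 : 0 < p) (_hp : ENNReal.ofReal p < TraceMonoid.minRoot R S),
      -- the output is a trace, and it follows the conditional law
      ((traceAlgorithm R c choose p S T).outputLaw none = 0 ∧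
        ∀ ξ : TraceMonoid R,
          (traceAlgorithm R c choose p S T).outputLaw (some ξ) =
            TraceMonoid.condBoltzmann R S T p {ξ}) ∧
      -- the number of steps, for every possible outcome of the execution
      (Nonempty A → ∀ o ∈ (traceAlgorithm R c choose p S T).outcomes,
        ∃ (ξ : TraceMonoid R) (n : ℕ), o = some (ξ, n) ∧
          n ≤ C * (Fintype.card A * (ξ.length + 1))) := by
  obtain ⟨α, hα⟩ : ∃ α, α = c.test + c.return_ := ⟨_, rfl⟩
  obtain ⟨β, hβ⟩ : ∃ β, β = α + (c.test + (c.choose + c.assign) +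
        (c.setOp + 2 * c.lookup + 2 * c.arith + c.assign) + 2 * c.assign +
        (c.loopControl + c.setOp + c.call) + (c.assign + c.mul + c.assign) + c.return_) +
      (c.loopControl + 2 * c.setOp + c.call) + (c.assign + 2 * c.mul + c.assign) + 1 := ⟨_, rfl⟩
  refine ⟨α + β, fun A _ _ R hrefl hsymm choose S T p hp0 hp => ?_⟩
  have hpos := TraceMonoid.mobiusAt_pos hrefl hsymm hp0 hp
  have hsteps := TraceMonoid.returns_traceAlgorithm hrefl hsymm c choose hp0 α β hα.ge hβ.ge S
    hpos T
  have hlaw := TraceMonoid.outputLaw_traceAlgorithm hrefl hsymm c choose hp0 S hpos T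
  have hnone := hsteps.outputLaw_none
  refine ⟨⟨hnone, fun ξ => ?_⟩, fun hA o ho => ?_⟩
  · rw [hlaw, TraceMonoid.condBoltzmann_singleton hp0 (hpos S subset_rfl)
      (hpos _ Finset.sdiff_subset)]
    -- the closed form sums to `1`, since it is the law of an output that is never `none`
    rw [← (traceAlgorithm R c choose p S T).outputLaw.tsum_coe,
      ← (Option.some_injective (TraceMonoid R)).tsum_eq]
    · exact tsum_congr fun x => (hlaw x).symm
    · intro o ho
      cases o with
      | none => exact absurd hnone ho
      | some x => exact ⟨x, rfl⟩
  · obtain ⟨ξ, n, rfl, hn⟩ := hsteps o ho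
    refine ⟨ξ, n, rfl, hn.trans ?_⟩
    have h1 : 1 ≤ Fintype.card A * (ξ.length + 1) :=
      Nat.mul_pos Fintype.card_pos (Nat.succ_pos _)
    calc α + β * S.card * (ξ.length + 1)
        ≤ α * (Fintype.card A * (ξ.length + 1)) + β * Fintype.card A * (ξ.length + 1) := by
          gcongr
          · exact Nat.le_mul_of_pos_right _ h1
          · exact Finset.card_le_univ S
      _ = (α + β) * (Fintype.card A * (ξ.length + 1)) := by ring
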